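/- Let $K$ be a field, $R=K[x_1,\ldots,x_n]$, and let $I\subseteq R$ be a generic monomial ideal: a monomial ideal such that, whenever two distinct minimal monomial generators $u,v$ of $I$ have the same positive degree in some variable, there is a third minimal monomial generator $w$ of $I$ that strictly divides $\operatorname{lcm}(u,v)$, i.e. $w$ divides $\operatorname{lcm}(u,v)$ and $\operatorname{lcm}(u,v)/w$ is divisible by every variable that divides $\operatorname{lcm}(u,v)$. A monomial prime filtration of $R/I$ is a chain of monomial ideals $\mathcal F: I=I_0\subset I_1\subset\cdots\subset I_r=R$ (with $r=0$ if $I=R$) such that for each $i=1,\ldots,r$ there is a monomial $u_i$ with $I_i=(I_{i-1},u_i)$ and $\mathfrak p_i=(I_{i-1}:u_i)$ a prime ideal; its support is $\operatorname{Supp}(\mathcal F)=\{\mathfrak p_1,\ldots,\mathfrak p_r\}$. Let $\operatorname{Ass}(I)$ be the set of associated primes of $R/I$, and $\min\operatorname{Ass}(I)$ the set of its minimal elements under inclusion. The module $R/I$ is called almost clean if it has a monomial prime filtration $\mathcal F$ with $\operatorname{Supp}(\mathcal F)=\operatorname{Ass}(I)$, and clean if it has a monomial prime filtration all of whose primes $\mathfrak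 p_i$ are minimal prime ideals of $I$. Then there is a monomial prime filtration $\mathcal F$ of $R/I$ with $\operatorname{Supp}(\mathcal F)=\operatorname{Ass}(I)$; that is, $R/I$ is almost clean. Moreover, $R/I$ is clean if and only if $\min\operatorname{Ass}(I)=\operatorname{Ass}(I)$. -/

import Mathlib

namespace MonomialFiltration

variable {n : ℕ} {K : Type*} [Field K]

/-- The monomial `x ^ a = x₁ ^ a₁ ⋯ xₙ ^ aₙ` of `K[x₁, …, xₙ]`. -/
noncomputable def mon (K : Type*) [Field K] (a : Fin n →₀ ℕ) : MvPolynomial (Fin n) K :=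
  MvPolynomial.monomial a 1

/-- A monomial ideal: an ideal generated by a set of monomials. The zero ideal and the unit
ideal are monomial ideals. -/
def IsMonomialIdeal (I : Ideal (MvPolynomial (Fin n) K)) : Prop :=
  ∃ S : Set (Fin n →₀ ℕ), I = Ideal.span (mon K '' S)

/-- (The exponent vectors of) the minimal monomial generators of a monomial ideal `I`: the
monomials in `I` that are minimal with respect to divisibility. -/
def minimalGenerators (I : Ideal (MvPolynomial (Fin n) K)) : Set (Fin n →₀ ℕ) :=
  {a | Minimal (fun b => mon K b ∈ I) a}

/-- `x ^ c` strictly divides `x ^ d`: it divides `x ^ d`, and the quotient has the same support as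
`x ^ d`. (The subtraction is truncated, but it is only used under `c ≤ d`.) -/
def StrictlyDivides (c d : Fin n →₀ ℕ) : Prop :=
  c ≤ d ∧ (d - c).support = d.support

/-- Generic monomial ideals: whenever two distinct minimal generators have the same positive
degree in some variable, a third minimal generator strictly divides their least common multiple.
The exponent vector of the least common multiple of `x ^ a` and `x ^ b` is `a ⊔ b`. -/
structure IsGeneric (I : Ideal (MvPolynomial (Fin n) K)) : Prop where
  isMonomialIdeal : IsMonomialIdeal I
  exists_strictlyDivides : ∀ a ∈ minimalGenerators I, ∀ b ∈ minimalGenerators I, a ≠ b →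
    (∃ s : Fin n, a s = b s ∧ 0 < a s) →
      ∃ c ∈ minimalGenerators I, c ≠ a ∧ c ≠ b ∧ StrictlyDivides c (a ⊔ b)

/-- A monomial prime filtration `I = I₀ ⊂ I₁ ⊂ ⋯ ⊂ I_r = R` of `R ⧸ I`: a chain of monomial ideals
with `I_{i+1} = (I_i, u_i)` for a monomial `u_i` such that `I_i : u_i` is a prime ideal. Primality
includes `I_i : u_i ≠ R`, that is `u_i ∉ I_i`, so the inclusions are strict. The length `r` is `0`
exactly when `I = R`. -/
structure MonomialPrimeFiltration (I : Ideal (MvPolynomial (Fin n) K)) where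
  length : ℕ
  ideal : Fin (length + 1) → Ideal (MvPolynomial (Fin n) K)
  exponent : Fin length → (Fin n →₀ ℕ)
  isMonomialIdeal : ∀ i, IsMonomialIdeal (ideal i)
  ideal_zero : ideal 0 = I
  ideal_last : ideal (Fin.last length) = ⊤
  ideal_succ : ∀ i : Fin length,
    ideal i.succ = ideal i.castSucc ⊔ Ideal.span {mon K (exponent i)}
  isPrime_colon : ∀ i : Fin length, ((ideal i.castSucc).colon {mon K (exponent i)}).IsPrime

/-- The support of a monomial prime filtration: the set of the primes `I_i : u_i`, for which
`I_{i+1} ⧸ I_i ≅ R ⧸ (I_i : u_i)`. -/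
def MonomialPrimeFiltration.supp {I : Ideal (MvPolynomial (Fin n) K)}
    (F : MonomialPrimeFiltration I) : Set (Ideal (MvPolynomial (Fin n) K)) :=
  Set.range fun i : Fin F.length => (F.ideal i.castSucc).colon {mon K (F.exponent i)}

/-- `Ass(I)`: the associated primes of the module `R ⧸ I`. -/
def Ass (I : Ideal (MvPolynomial (Fin n) K)) : Set (Ideal (MvPolynomial (Fin n) K)) :=
  associatedPrimes (MvPolynomial (Fin n) K) (MvPolynomial (Fin n) K ⧸ I)

/-- `min Ass(I)`: the associated primes of `R ⧸ I` that are minimal under inclusion among the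
associated primes. -/
def minAss (I : Ideal (MvPolynomial (Fin n) K)) : Set (Ideal (MvPolynomial (Fin n) K)) :=
  {p | Minimal (fun q => q ∈ Ass I) p}

/-- `R ⧸ I` is clean: it has a monomial prime filtration all of whose primes are minimal prime
ideals of `I`. -/
def IsClean (I : Ideal (MvPolynomial (Fin n) K)) : Prop :=
  ∃ F : MonomialPrimeFiltration I, ∀ p ∈ F.supp, p ∈ I.minimalPrimes

/-- `R ⧸ I` is almost clean: it has a monomial prime filtration whose support is `Ass(I)`. -/
def IsAlmostClean (I : Ideal (MvPolynomial (Fin n) K)) : Prop :=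
  ∃ F : MonomialPrimeFiltration I, F.supp = Ass I

end MonomialFiltration

/-! Induct on the variables occurring in the generators. Fix a variable `s`; let `I_j` be generated
by the generators of `s`-degree at most `j`, with `s` set to `1`. The ideals `I + I_j` climb from
`I` (at `j = 0`) to an ideal whose generators do not involve `s`. Between levels `j` and `j + 1`,
each generator `g` of `s`-degree `j + 1` is adjoined with its power of `s` lowered one unit at a
time.

Genericity makes every colon met on the way equal to `(I_j : g) + (x_s)`: if `h`, of the same
`s`-degree, was adjoined before `g`, some generator strictly dividing `lcm(g, h)` has `s`-degree at
most `j`, so `h` contributes nothing new. The ideal `I_j : g` is again generic, in fewer variables,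
so induction filters it (`chain_levelSet_insert`, `GenericSet.exists_chain`). All primes that occur
are colons of `I` itself by monomials (`primeColons_slice_colon`, `primeColons_slice_top`), hence
associated.

Conversely, the support of any filtration contains `Ass I` (`Ass_subset_supp`). The cleanness
criterion follows, since the minimal primes of `I` are the minimal elements of `Ass I`. -/

namespace MonomialFiltration

/-! ### Chains of upper sets of exponent vectors. -/

section Combinatorics

variable {σ : Type*}

/-- One step of a prime filtration, on the level of sets of exponent vectors: `V` arises from `U`
by adding the multiples of some `x ^ a` for which `U : x ^ a` is the prime generated by the
variables in a member `T` of `𝒯`. -/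
def PrimeStep (𝒯 : Set (Set σ)) (U V : Set (σ →₀ ℕ)) : Prop :=
  ∃ a, ∃ T ∈ 𝒯, (∀ b, a + b ∈ U ↔ ∃ t ∈ T, 0 < b t) ∧ V = U ∪ Set.Ici a

/-- The sets of variables that generate a prime of the form `U : x ^ a`. -/
def primeColons (U : Set (σ →₀ ℕ)) : Set (Set σ) :=
  {T | ∃ a, ∀ b, a + b ∈ U ↔ ∃ t ∈ T, 0 < b t}

/-- The exponent vectors of the multiples of the monomials with exponents in `G`. -/
def multiples (G : Finset (σ →₀ ℕ)) : Set (σ →₀ ℕ) :=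
  {x | ∃ g ∈ G, g ≤ x}

/-- Genericity of a finite set of monomials. -/
def GenericSet (G : Finset (σ →₀ ℕ)) : Prop :=
  ∀ a ∈ G, ∀ b ∈ G, a ≠ b → ∀ t, a t = b t → 0 < a t →
    ∃ c ∈ G, ∀ r, c r ≤ max (a r) (b r) - 1

open Relation

theorem PrimeStep.mono {𝒯 𝒯' : Set (Set σ)} (h : 𝒯 ⊆ 𝒯') {U V : Set (σ →₀ ℕ)}
    (hs : PrimeStep 𝒯 U V) : PrimeStep 𝒯' U V := by
  obtain ⟨a, T, hT, h1, h2⟩ := hs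
  exact ⟨a, T, h hT, h1, h2⟩

theorem subset_of_chain {𝒯 : Set (Set σ)} {U V : Set (σ →₀ ℕ)}
    (h : ReflTransGen (PrimeStep 𝒯) U V) : U ⊆ V := by
  induction h with
  | refl => exact subset_rfl
  | tail _ hs ih =>
    obtain ⟨a, T, -, -, rfl⟩ := hs
    exact ih.trans Set.subset_union_left

/-- A chain from `L : x ^ c` to the whole ring gives a chain from `L` to `(L, x ^ c)`. -/
theorem chain_union_Ici {𝒯 : Set (Set σ)} {L W : Set (σ →₀ ℕ)} {c : σ →₀ ℕ}
    (hW : ∀ b, b ∈ W ↔ c + b ∈ L) (h : ReflTransGen (PrimeStep 𝒯) W Set.univ) :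
    ReflTransGen (PrimeStep 𝒯) L (L ∪ Set.Ici c) := by
  have key : ∀ V, ReflTransGen (PrimeStep 𝒯) W V →
      ReflTransGen (PrimeStep 𝒯) L (L ∪ (fun b => c + b) '' V) := by
    intro V hV
    induction hV with
    | refl =>
      rw [Set.union_eq_self_of_subset_right]
      rintro _ ⟨b, hb, rfl⟩
      exact (hW b).1 hb
    | tail hV hs ih =>
      refine ih.tail ?_
      obtain ⟨a, T, hT, h1, rfl⟩ := hs
      refine ⟨c + a, T, hT, fun b => ?_, ?_⟩
      · rw [← h1 b, add_assoc]
        constructor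
        · rintro (h | ⟨x, hx, hxe⟩)
          -- Elements of `L` above `c` come from `W`, which every member of the chain contains.
          · exact subset_of_chain hV ((hW _).2 h)
          · rwa [← add_left_cancel hxe]
        · exact fun h => Or.inr ⟨_, h, rfl⟩
      · rw [Set.image_union, Set.union_assoc, Set.image_const_add_Ici]
  have := key _ h
  rwa [Set.image_univ, show Set.range (fun b => c + b) = Set.Ici c from by
    ext x; exact ⟨fun ⟨b, hb⟩ => hb ▸ (le_self_add : c ≤ c + b), fun hx => ⟨x - c, add_tsub_cancel_of_le hx⟩⟩]
    at this

/-- Adding a variable to all members of a chain. -/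
theorem chain_union_variable {𝒯 : Set (Set σ)} {U V : Set (σ →₀ ℕ)} (s : σ)
    (h : ReflTransGen (PrimeStep 𝒯) U V) :
    ReflTransGen (PrimeStep (insert s '' 𝒯)) (U ∪ {b | 0 < b s}) (V ∪ {b | 0 < b s}) := by
  refine ReflTransGen.lift' (fun W => W ∪ {b : σ →₀ ℕ | 0 < b s}) ?_ _ _ h
  rintro U _ ⟨a, T, hT, h1, rfl⟩
  simp only [Function.onFun]
  -- If `x_s` divides `x ^ a`, the step collapses and is dropped; otherwise its prime gains `x_s`.
  rcases Nat.eq_zero_or_pos (a s) with ha | ha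
  · refine ReflTransGen.single ⟨a, insert s T, ⟨T, hT, rfl⟩, fun b => ?_, Set.union_right_comm _ _ _⟩
    simp [h1, ha, or_comm]
  · have : U ∪ Set.Ici a ∪ {b | 0 < b s} = U ∪ {b | 0 < b s} := by
      rw [Set.union_assoc, Set.union_eq_self_of_subset_left (s := Set.Ici a)]
      exact fun x hx => ha.trans_le (hx s)
    rw [this]

/-! ### Slices and colons of generic sets. -/

variable [DecidableEq σ]

/-- The generators of the slice in which the variable `s` has degree `j`. -/
noncomputable def sliceSet (G : Finset (σ →₀ ℕ)) (s : σ) (j : ℕ) : Finset (σ →₀ ℕ) :=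
  (G.filter fun g => g s ≤ j).image (Finsupp.erase s)

/-- Generators of the colon by `x ^ m`. -/
noncomputable def colonSet (G : Finset (σ →₀ ℕ)) (m : σ →₀ ℕ) : Finset (σ →₀ ℕ) :=
  G.image (· - m)

theorem mem_multiples_slice {G : Finset (σ →₀ ℕ)} {s : σ} {j : ℕ} {x : σ →₀ ℕ} :
    x ∈ multiples (sliceSet G s j) ↔ ∃ g ∈ G, g s ≤ j ∧ ∀ r ≠ s, g r ≤ x r := by
  simp only [multiples, sliceSet, Finset.mem_image, Finset.mem_filter, Set.mem_ofPred_eq]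
  constructor
  · rintro ⟨_, ⟨g, ⟨hg, hj⟩, rfl⟩, h⟩
    refine ⟨g, hg, hj, fun r hr => ?_⟩
    simpa [Finsupp.erase_ne hr] using h r
  · rintro ⟨g, hg, hj, h⟩
    refine ⟨_, ⟨g, ⟨hg, hj⟩, rfl⟩, fun r => ?_⟩
    by_cases hr : r = s
    · simp [hr]
    · simpa [Finsupp.erase_ne hr] using h r hr

theorem mem_multiples_colonSet {G : Finset (σ →₀ ℕ)} {m x : σ →₀ ℕ} :
    x ∈ multiples (colonSet G m) ↔ m + x ∈ multiples G := by
  simp [multiples, colonSet, add_comm]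

/-- `GenericSet` does not ask for minimal generators, which slices and colons need not preserve;
this is what lets the induction run. -/
theorem GenericSet.slice {G : Finset (σ →₀ ℕ)} (hG : GenericSet G) (s : σ) (j : ℕ) :
    GenericSet (sliceSet G s j) := by
  simp only [GenericSet, sliceSet, Finset.mem_image, Finset.mem_filter]
  rintro _ ⟨a, ⟨ha, haj⟩, rfl⟩ _ ⟨b, ⟨hb, hbj⟩, rfl⟩ hab t ht hpos
  have hts : t ≠ s := by
    rintro rfl
    simp at hpos
  rw [Finsupp.erase_ne hts] at hpos
  rw [Finsupp.erase_ne hts, Finsupp.erase_ne hts] at ht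
  obtain ⟨c, hc, h⟩ := hG a ha b hb (fun h => hab (h ▸ rfl)) t ht hpos
  refine ⟨_, ⟨c, ⟨hc, ?_⟩, rfl⟩, fun r => ?_⟩
  · have := h s
    omega
  · by_cases hr : r = s
    · simp [hr]
    · simpa [Finsupp.erase_ne hr] using h r

theorem GenericSet.colon {G : Finset (σ →₀ ℕ)} (hG : GenericSet G) (m : σ →₀ ℕ) :
    GenericSet (colonSet G m) := by
  simp only [GenericSet, colonSet, Finset.mem_image]
  rintro _ ⟨a, ha, rfl⟩ _ ⟨b, hb, rfl⟩ hab t ht hpos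
  simp only [Finsupp.tsub_apply] at ht hpos
  obtain ⟨c, hc, h⟩ := hG a ha b hb (fun h => hab (h ▸ rfl)) t (by omega) (by omega)
  refine ⟨_, ⟨c, hc, rfl⟩, fun r => ?_⟩
  have := h r
  simp only [Finsupp.tsub_apply]
  omega

/-! ### Climbing the levels of one variable. -/

/-- The exponents of the ideal generated by `G`, the slice of degree `j`, and the members of `H` with the variable
`s` set to `1`. -/
def levelSet (G : Finset (σ →₀ ℕ)) (s : σ) (j : ℕ) (H : Finset (σ →₀ ℕ)) : Set (σ →₀ ℕ) :=
  {x | x ∈ multiples G ∨ x ∈ multiples (sliceSet G s j) ∨ ∃ h ∈ H, ∀ r ≠ s, h r ≤ x r}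

theorem primeColons_slice_colon {G : Finset (σ →₀ ℕ)} {s : σ} {j : ℕ} {g : σ →₀ ℕ}
    (hg : g ∈ G) (hgs : g s = j + 1) :
    insert s '' primeColons (multiples (colonSet (sliceSet G s j) g)) ⊆ primeColons (multiples G) := by
  rintro _ ⟨T, ⟨a, ha⟩, rfl⟩
  -- At `s`-degree exactly `j` only the slice is visible; one more factor `x_s` makes the monomial a
  -- multiple of `g`.
  refine ⟨(g + a).update s j, fun b => ?_⟩
  rcases Nat.eq_zero_or_pos (b s) with hb | hb
  · have : (∃ t ∈ insert s T, 0 < b t) ↔ ∃ t ∈ T, 0 < b t := by simp [hb]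
    rw [this, ← ha, mem_multiples_colonSet, mem_multiples_slice]
    constructor
    · rintro ⟨c, hc, h⟩
      refine ⟨c, hc, by simpa [hb] using h s, fun r hr => ?_⟩
      simpa [Function.update_of_ne hr, add_assoc] using h r
    · rintro ⟨c, hc, hcs, h⟩
      refine ⟨c, hc, fun r => ?_⟩
      by_cases hr : r = s
      · subst hr; simpa [hb] using hcs
      · simpa [Function.update_of_ne hr, add_assoc] using h r hr
  · refine iff_of_true ⟨g, hg, fun r => ?_⟩ ⟨s, Set.mem_insert _ _, hb⟩
    by_cases hr : r = s
    · subst hr; simp; omega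
    · simp [Function.update_of_ne hr, add_assoc]

theorem primeColons_slice_top {G : Finset (σ →₀ ℕ)} {s : σ} {q : ℕ} (hq : ∀ g ∈ G, g s ≤ q) :
    primeColons (multiples (sliceSet G s q)) ⊆ primeColons (multiples G) := by
  rintro T ⟨a, ha⟩
  -- With `s`-degree `q` no generator is constrained in `s` any more.
  refine ⟨a.update s q, fun b => ?_⟩
  rw [← ha, mem_multiples_slice]
  constructor
  · rintro ⟨c, hc, h⟩
    refine ⟨c, hc, hq c hc, fun r hr => ?_⟩
    simpa [Function.update_of_ne hr] using h r
  · rintro ⟨c, hc, -, h⟩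
    refine ⟨c, hc, fun r => ?_⟩
    by_cases hr : r = s
    · subst hr; simpa using (hq c hc).trans (by omega)
    · simpa [Function.update_of_ne hr] using h r hr

theorem chain_levelSet_insert {G : Finset (σ →₀ ℕ)} (hG : GenericSet G) {s : σ} {j : ℕ}
    {H : Finset (σ →₀ ℕ)} (hH : ∀ h ∈ H, h ∈ G ∧ h s = j + 1) {g : σ →₀ ℕ} (hg : g ∈ G)
    (hgs : g s = j + 1) (hgH : g ∉ H)
    (ih : ReflTransGen (PrimeStep (primeColons (multiples (colonSet (sliceSet G s j) g))))
      (multiples (colonSet (sliceSet G s j) g)) Set.univ) :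
    ReflTransGen (PrimeStep (primeColons (multiples G))) (levelSet G s j H)
      (levelSet G s j (insert g H)) := by
  have step : ∀ k ≤ j, ReflTransGen (PrimeStep (primeColons (multiples G)))
      (levelSet G s j H ∪ Set.Ici (g.update s (k + 1)))
      (levelSet G s j H ∪ Set.Ici (g.update s k)) := by
    intro k hk
    have hle : g.update s k ≤ g.update s (k + 1) := by
      intro r
      by_cases hr : r = s
      · subst hr; simp
      · simp [Function.update_of_ne hr]
    have heq : levelSet G s j H ∪ Set.Ici (g.update s k) =
        levelSet G s j H ∪ Set.Ici (g.update s (k + 1)) ∪ Set.Ici (g.update s k) := by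
      rw [Set.union_assoc, Set.union_eq_self_of_subset_left (s := Set.Ici (g.update s (k + 1)))]
      exact Set.Ici_subset_Ici.2 hle
    rw [heq]
    have hch := ReflTransGen.mono (fun _ _ => PrimeStep.mono (primeColons_slice_colon hg hgs)) _ _
      (chain_union_variable s ih)
    rw [Set.univ_union] at hch
    -- It remains to identify the colon by `g.update s k` with `(I_j : g) + (x_s)`.
    refine chain_union_Ici (fun b => ?_) hch
    rw [Set.mem_union, mem_multiples_colonSet, Set.mem_ofPred_eq]
    rcases Nat.eq_zero_or_pos (b s) with hb | hb
    · simp only [hb, lt_irrefl, or_false]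
      have key : g.update s k + b ∈ multiples (sliceSet G s j) ↔
          g + b ∈ multiples (sliceSet G s j) := by
        simp only [mem_multiples_slice]
        refine exists_congr fun c => and_congr_right fun _ => and_congr_right fun _ =>
          forall₂_congr fun r hr => ?_
        simp [Function.update_of_ne hr]
      rw [← key]
      refine ⟨fun h => Or.inl (Or.inr (Or.inl h)), ?_⟩
      rintro ((⟨c, hc, h⟩ | h | ⟨h, hhH, hle'⟩) | h)
      · refine mem_multiples_slice.2 ⟨c, hc, ?_, fun r _ => h r⟩
        have := h s
        simp [hb] at this
        omega
      · exact h
      · obtain ⟨hhG, hhs⟩ := hH h hhH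
        -- Genericity at the common `s`-degree `j + 1`: `c` has `s`-degree at most `j`, and away
        -- from `s` it divides `lcm(g, h)`.
        obtain ⟨c, hc, hcle⟩ := hG g hg h hhG (fun e => hgH (e ▸ hhH)) s (by omega) (by omega)
        refine mem_multiples_slice.2 ⟨c, hc, ?_, fun r hr => ?_⟩
        · have := hcle s
          omega
        · have h1 := hcle r
          have h2 := hle' r hr
          simp only [Finsupp.add_apply, Finsupp.coe_update, Function.update_of_ne hr] at h2 ⊢
          omega
      · have := h s
        simp [hb] at this
    · refine iff_of_true (Or.inr hb) (Or.inr fun r => ?_)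
      by_cases hr : r = s
      · subst hr; simp; omega
      · simp [Function.update_of_ne hr]
  have down : ∀ k ≤ j + 1, ReflTransGen (PrimeStep (primeColons (multiples G)))
      (levelSet G s j H ∪ Set.Ici (g.update s (j + 1)))
      (levelSet G s j H ∪ Set.Ici (g.update s k)) := by
    intro k hk
    induction hk using Nat.decreasingInduction with
    | of_succ k hk ih => exact ih.trans (step k (Nat.lt_succ_iff.1 hk))
    | self => exact ReflTransGen.refl
  have h0 := down 0 (Nat.zero_le _)
  -- The descent starts at `g` itself, which already lies in the level set.
  rw [← hgs, Finsupp.update_self, Set.union_eq_self_of_subset_right] at h0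
  · convert h0 using 1
    ext x
    have : x ∈ Set.Ici (g.update s 0) ↔ ∀ r ≠ s, g r ≤ x r := by
      refine ⟨fun h r hr => by simpa [Function.update_of_ne hr] using h r, fun h r => ?_⟩
      by_cases hr : r = s
      · subst hr; simp
      · simpa [Function.update_of_ne hr] using h r hr
    rw [Set.mem_union, this]
    simp only [levelSet, Set.mem_ofPred_eq, Finset.mem_insert, exists_eq_or_imp]
    rw [or_comm (a := ∀ r, r ≠ s → g r ≤ x r), or_assoc, or_assoc]
  · exact fun x hx => Or.inl ⟨g, hg, hx⟩

theorem levelSet_succ (G : Finset (σ →₀ ℕ)) (s : σ) (j : ℕ) :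
    levelSet G s j (G.filter fun g => g s = j + 1) = levelSet G s (j + 1) ∅ := by
  ext x
  simp only [levelSet, Set.mem_ofPred_eq, mem_multiples_slice, Finset.mem_filter,
    Finset.notMem_empty, false_and, exists_false, or_false]
  refine or_congr_right ⟨?_, ?_⟩
  · rintro (⟨g, hg, hj, h⟩ | ⟨g, ⟨hg, hj⟩, h⟩)
    · exact ⟨g, hg, by omega, h⟩
    · exact ⟨g, hg, by omega, h⟩
  · rintro ⟨g, hg, hj, h⟩
    rcases Nat.lt_or_ge j (g s) with hlt | hle
    · exact Or.inr ⟨g, ⟨hg, by omega⟩, h⟩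
    · exact Or.inl ⟨g, hg, hle, h⟩

theorem levelSet_zero (G : Finset (σ →₀ ℕ)) (s : σ) : levelSet G s 0 ∅ = multiples G := by
  ext x
  simp only [levelSet, Set.mem_ofPred_eq, Finset.notMem_empty, false_and, exists_false, or_false]
  refine ⟨?_, Or.inl⟩
  rintro (h | h)
  · exact h
  · obtain ⟨g, hg, hj, h⟩ := mem_multiples_slice.1 h
    refine ⟨g, hg, fun r => ?_⟩
    by_cases hr : r = s
    · subst hr; omega
    · exact h r hr

theorem levelSet_top {G : Finset (σ →₀ ℕ)} {s : σ} {q : ℕ} (hq : ∀ g ∈ G, g s ≤ q) :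
    levelSet G s q ∅ = multiples (sliceSet G s q) := by
  ext x
  simp only [levelSet, Set.mem_ofPred_eq, Finset.notMem_empty, false_and, exists_false, or_false]
  refine ⟨?_, Or.inr⟩
  rintro (⟨g, hg, h⟩ | h)
  · exact mem_multiples_slice.2 ⟨g, hg, hq g hg, fun r _ => h r⟩
  · exact h

/-- A generic monomial ideal has a prime filtration (on the level of exponents) all of whose primes
are colons of the ideal by monomials. -/
theorem GenericSet.exists_chain (S : Finset σ) : ∀ G : Finset (σ →₀ ℕ), GenericSet G →
    (∀ g ∈ G, ∀ r ∉ S, g r = 0) →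
    ReflTransGen (PrimeStep (primeColons (multiples G))) (multiples G) Set.univ := by
  induction S using Finset.induction_on with
  | empty =>
    intro G _ hS
    have hS' : ∀ g ∈ G, g = 0 := fun g hg => Finsupp.ext fun r => hS g hg r (by simp)
    rcases G.eq_empty_or_nonempty with rfl | ⟨g, hg⟩
    -- The zero ideal is prime, so one step with `a = 0` and `T = ∅` reaches the whole ring.
    · have h0 : ∀ b, (0 : σ →₀ ℕ) + b ∈ multiples ∅ ↔ ∃ t ∈ (∅ : Set σ), 0 < b t := by
        simp [multiples]
      refine ReflTransGen.single ⟨0, ∅, ⟨0, h0⟩, h0, ?_⟩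
      ext x
      simp
    · have : multiples G = Set.univ :=
        Set.eq_univ_of_forall fun x => ⟨g, hg, hS' g hg ▸ zero_le⟩
      rw [this]
  | insert s S hs ih =>
    intro G hG hS
    have hslice : ∀ j, ∀ g ∈ sliceSet G s j, ∀ r ∉ S, g r = 0 := by
      intro j g hg r hr
      obtain ⟨g, hgf, rfl⟩ := Finset.mem_image.1 hg
      by_cases hrs : r = s
      · simp [hrs]
      · rw [Finsupp.erase_ne hrs]
        exact hS g (Finset.mem_filter.1 hgf).1 r (by simp [hrs, hr])
    have level : ∀ j, ReflTransGen (PrimeStep (primeColons (multiples G)))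
        (levelSet G s j ∅) (levelSet G s (j + 1) ∅) := by
      intro j
      rw [← levelSet_succ]
      have aux : ∀ H : Finset (σ →₀ ℕ), (∀ h ∈ H, h ∈ G ∧ h s = j + 1) →
          ReflTransGen (PrimeStep (primeColons (multiples G)))
            (levelSet G s j ∅) (levelSet G s j H) := by
        intro H
        induction H using Finset.induction_on with
        | empty => exact fun _ => ReflTransGen.refl
        | insert g H hgH ihH =>
          intro hH
          have hH' : ∀ h ∈ H, h ∈ G ∧ h s = j + 1 := fun h hh => hH h (Finset.mem_insert_of_mem hh)
          obtain ⟨hg, hgs⟩ := hH g (Finset.mem_insert_self _ _)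
          refine (ihH hH').trans (chain_levelSet_insert hG hH' hg hgs hgH ?_)
          refine ih _ ((hG.slice s j).colon g) fun c hc r hr => ?_
          obtain ⟨c, hc', rfl⟩ := Finset.mem_image.1 hc
          simp [hslice j c hc' r hr]
      exact aux _ fun h hh => Finset.mem_filter.1 hh
    have up : ∀ q, ReflTransGen (PrimeStep (primeColons (multiples G)))
        (multiples G) (levelSet G s q ∅) := by
      intro q
      induction q with
      | zero => rw [levelSet_zero]
      | succ q ihq => exact ihq.trans (level q)
    have hq : ∀ g ∈ G, g s ≤ G.sup fun g => g s := fun g hg => Finset.le_sup (f := fun g => g s) hg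
    have h1 := up (G.sup fun g => g s)
    rw [levelSet_top hq] at h1
    exact h1.trans (ReflTransGen.mono (fun _ _ => PrimeStep.mono (primeColons_slice_top hq)) _ _
      (ih _ (hG.slice s _) (hslice _)))

end Combinatorics

/-! ### From exponent sets to ideals and filtrations. -/

section Ideals

open MvPolynomial Relation

variable {n : ℕ} {K : Type*} [Field K]

/-- The ideal spanned by the monomials with exponents in `U`. -/
noncomputable def expIdeal (K : Type*) [Field K] (U : Set (Fin n →₀ ℕ)) :
    Ideal (MvPolynomial (Fin n) K) :=
  Ideal.span (mon K '' U)

theorem mem_expIdeal {U : Set (Fin n →₀ ℕ)} (hU : IsUpperSet U) {f : MvPolynomial (Fin n) K} :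
    f ∈ expIdeal K U ↔ ∀ d ∈ f.support, d ∈ U :=
  mem_ideal_span_monomial_image.trans
    ⟨fun h d hd => let ⟨_, he, hed⟩ := h d hd; hU hed he, fun h d hd => ⟨d, h d hd, le_rfl⟩⟩

theorem isUpperSet_translate {U : Set (Fin n →₀ ℕ)} (hU : IsUpperSet U) (a : Fin n →₀ ℕ) :
    IsUpperSet {b | a + b ∈ U} :=
  fun _ _ hbc hb => hU (add_le_add_right hbc a) hb

theorem colon_expIdeal {U : Set (Fin n →₀ ℕ)} (hU : IsUpperSet U) (a : Fin n →₀ ℕ) :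
    (expIdeal K U).colon {mon K a} = expIdeal K {b | a + b ∈ U} := by
  ext f
  rw [Submodule.mem_colon_singleton, smul_eq_mul, mem_expIdeal hU,
    mem_expIdeal (isUpperSet_translate hU a)]
  simp only [mem_support_iff, mon]
  constructor
  · intro h d hd
    have := h (d + a) (by rwa [coeff_mul_monomial, mul_one])
    rwa [add_comm] at this
  · intro h d hd
    rw [coeff_mul_monomial'] at hd
    split_ifs at hd with had
    · have := h (d - a) (by simpa using hd)
      rwa [Set.mem_ofPred_eq, add_tsub_cancel_of_le had] at this
    · exact absurd rfl hd

/-- The ideal is the kernel of the endomorphism `φ` killing the variables in `T`, whose target is a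
domain; `φ` is the identity modulo the ideal, so its kernel is no larger. -/
theorem isPrime_expIdeal_variables (T : Set (Fin n)) :
    (expIdeal K {b : Fin n →₀ ℕ | ∃ t ∈ T, 0 < b t}).IsPrime := by
  classical
  set P := expIdeal K {b : Fin n →₀ ℕ | ∃ t ∈ T, 0 < b t} with hP
  let φ : MvPolynomial (Fin n) K →ₐ[K] MvPolynomial (Fin n) K :=
    aeval fun t => if t ∈ T then 0 else X t
  have hX : ∀ t ∈ T, (X t : MvPolynomial (Fin n) K) ∈ P := fun t ht =>
    Ideal.subset_span ⟨Finsupp.single t 1, ⟨t, ht, by simp⟩, rfl⟩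
  have hmk : (Ideal.Quotient.mkₐ K P).comp φ = Ideal.Quotient.mkₐ K P := by
    refine algHom_ext fun t => ?_
    by_cases ht : t ∈ T
    · have := Ideal.Quotient.eq_zero_iff_mem.2 (hX t ht)
      simp [φ, ht, this]
    · simp [φ, ht]
  have hker : P = RingHom.ker φ := by
    refine le_antisymm (Ideal.span_le.2 ?_) fun f hf => ?_
    · rintro _ ⟨b, ⟨t, ht, hb⟩, rfl⟩
      have : (mon K b : MvPolynomial (Fin n) K) = mon K (b - Finsupp.single t 1) * X t := by
        rw [mon, mon, X, monomial_mul, mul_one, tsub_add_cancel_of_le]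
        exact Finsupp.single_le_iff.2 hb
      rw [SetLike.mem_coe, RingHom.mem_ker, this, map_mul]
      simp [φ, ht]
    · have := DFunLike.congr_fun hmk f
      rw [AlgHom.comp_apply, (RingHom.mem_ker).1 hf, map_zero] at this
      exact Ideal.Quotient.eq_zero_iff_mem.1 this.symm
  rw [hker]
  exact RingHom.ker_isPrime _

theorem expIdeal_union_Ici (U : Set (Fin n →₀ ℕ)) (a : Fin n →₀ ℕ) :
    expIdeal K (U ∪ Set.Ici a) = expIdeal K U ⊔ Ideal.span {mon K a} := by
  rw [expIdeal, Set.image_union, Ideal.span_union, ← expIdeal]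
  congr 1
  refine le_antisymm (Ideal.span_le.2 ?_) (Ideal.span_mono ?_)
  · rintro _ ⟨b, hb, rfl⟩
    refine Ideal.mem_span_singleton.2 ⟨mon K (b - a), ?_⟩
    rw [mon, mon, mon, monomial_mul, mul_one, add_tsub_cancel_of_le hb]
  · rintro _ rfl
    exact ⟨a, Set.self_mem_Ici, rfl⟩

/-- Prepending a step to a monomial prime filtration. -/
noncomputable def MonomialPrimeFiltration.cons {I J : Ideal (MvPolynomial (Fin n) K)}
    (F : MonomialPrimeFiltration J) (a : Fin n →₀ ℕ) (hI : IsMonomialIdeal I)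
    (hJ : J = I ⊔ Ideal.span {mon K a}) (hp : (I.colon {mon K a}).IsPrime) :
    MonomialPrimeFiltration I where
  length := F.length + 1
  ideal := Fin.cons I F.ideal
  exponent := Fin.cons a F.exponent
  isMonomialIdeal := Fin.cases hI F.isMonomialIdeal
  ideal_zero := rfl
  ideal_last := F.ideal_last
  ideal_succ := Fin.cases (F.ideal_zero.trans hJ) F.ideal_succ
  isPrime_colon := Fin.cases hp F.isPrime_colon

theorem MonomialPrimeFiltration.supp_cons {I J : Ideal (MvPolynomial (Fin n) K)}
    (F : MonomialPrimeFiltration J) (a : Fin n →₀ ℕ) (hI : IsMonomialIdeal I)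
    (hJ : J = I ⊔ Ideal.span {mon K a}) (hp : (I.colon {mon K a}).IsPrime) :
    (F.cons a hI hJ hp).supp ⊆ insert (I.colon {mon K a}) F.supp := by
  rintro _ ⟨i, rfl⟩
  revert i
  exact Fin.cases (Or.inl rfl) fun i => Or.inr ⟨i, rfl⟩

theorem expIdeal_univ : expIdeal K (Set.univ : Set (Fin n →₀ ℕ)) = ⊤ :=
  (Ideal.eq_top_iff_one _).2 (Ideal.subset_span ⟨0, Set.mem_univ _, rfl⟩)

theorem colon_expIdeal_eq_of_prime {U : Set (Fin n →₀ ℕ)} (hU : IsUpperSet U) {a : Fin n →₀ ℕ}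
    {T : Set (Fin n)} (h : ∀ b, a + b ∈ U ↔ ∃ t ∈ T, 0 < b t) :
    (expIdeal K U).colon {mon K a} = expIdeal K {b | ∃ t ∈ T, 0 < b t} := by
  rw [colon_expIdeal hU]
  exact congrArg _ (Set.ext h)

/-- A chain of prime steps gives a monomial prime filtration. -/
theorem exists_filtration_of_chain {𝒯 : Set (Set (Fin n))} {U : Set (Fin n →₀ ℕ)}
    (hU : IsUpperSet U) (h : ReflTransGen (PrimeStep 𝒯) U Set.univ) :
    ∃ F : MonomialPrimeFiltration (expIdeal K U),
      F.supp ⊆ {p | ∃ T ∈ 𝒯, p = expIdeal K {b | ∃ t ∈ T, 0 < b t}} := by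
  induction h using ReflTransGen.head_induction_on with
  | refl =>
    refine ⟨⟨0, fun _ => expIdeal K Set.univ, Fin.elim0, fun _ => ⟨_, rfl⟩, rfl, expIdeal_univ,
      fun i => i.elim0, fun i => i.elim0⟩, ?_⟩
    rintro _ ⟨i, -⟩
    exact i.elim0
  | head hs _ ih =>
    obtain ⟨a, T, hT, h1, rfl⟩ := hs
    obtain ⟨F, hF⟩ := ih (hU.union (isUpperSet_Ici a))
    have hc := colon_expIdeal_eq_of_prime (K := K) hU h1
    refine ⟨F.cons a ⟨_, rfl⟩ (expIdeal_union_Ici _ a)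
      (hc ▸ isPrime_expIdeal_variables T), ?_⟩
    refine (F.supp_cons _ _ _ _).trans (Set.insert_subset ⟨T, hT, hc⟩ hF)

/-! ### Associated primes and supports. -/

theorem colon_mem_Ass {I : Ideal (MvPolynomial (Fin n) K)} {f : MvPolynomial (Fin n) K}
    (h : (I.colon {f}).IsPrime) : I.colon {f} ∈ Ass I := by
  refine isAssociatedPrime_iff.2 ⟨h, Ideal.Quotient.mk I f, ?_⟩
  ext g
  rw [Submodule.mem_colon_singleton, Submodule.mem_colon_singleton, Submodule.mem_bot,
    ← Ideal.Quotient.eq_zero_iff_mem, smul_eq_mul, map_mul]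
  rfl

theorem mem_Ass_iff {I p : Ideal (MvPolynomial (Fin n) K)} :
    p ∈ Ass I ↔ p.IsPrime ∧ ∃ f, p = I.colon {f} := by
  refine ⟨fun h => ?_, fun ⟨hp, f, hf⟩ => hf ▸ colon_mem_Ass (hf ▸ hp)⟩
  obtain ⟨hp, x, hx⟩ := isAssociatedPrime_iff.1 h
  obtain ⟨f, rfl⟩ := Ideal.Quotient.mk_surjective x
  refine ⟨hp, f, hx.trans ?_⟩
  ext g
  rw [Submodule.mem_colon_singleton, Submodule.mem_colon_singleton, Submodule.mem_bot,
    ← Ideal.Quotient.eq_zero_iff_mem, smul_eq_mul, map_mul]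
  rfl

theorem le_of_mem_Ass {I p : Ideal (MvPolynomial (Fin n) K)} (h : p ∈ Ass I) : I ≤ p := by
  obtain ⟨-, f, rfl⟩ := mem_Ass_iff.1 h
  exact Ideal.le_colon

/-- The associated primes along one step `I ⊂ (I, u)` with `I : u` prime. -/
theorem Ass_subset_insert {I : Ideal (MvPolynomial (Fin n) K)} {u : MvPolynomial (Fin n) K}
    (h : (I.colon {u}).IsPrime) :
    Ass I ⊆ insert (I.colon {u}) (Ass (I ⊔ Ideal.span {u})) := by
  intro p hp
  obtain ⟨hprime, f, hf⟩ := mem_Ass_iff.1 hp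
  have hmem : ∀ g, g ∈ p ↔ g * f ∈ I := fun g => by
    rw [hf, Submodule.mem_colon_singleton, smul_eq_mul]
  by_cases hex : ∃ g, g ∉ p ∧ g * f ∈ I ⊔ Ideal.span {u}
  -- Here `g * f` is congruent to `e * u` modulo `I`, with `g ∉ p` and `e ∉ I : u`. Such factors do
  -- not change a prime colon, so `p = I : gf = I : eu = I : u`.
  · obtain ⟨g, hg, hgf⟩ := hex
    obtain ⟨y, hy, z, hz, hyz⟩ := Submodule.mem_sup.1 hgf
    obtain ⟨e, rfl⟩ := Ideal.mem_span_singleton'.1 hz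
    have he : e ∉ I.colon {u} := by
      intro he
      rw [Submodule.mem_colon_singleton, smul_eq_mul] at he
      exact hg ((hmem g).2 (hyz ▸ I.add_mem hy he))
    left
    ext q
    have h1 : q ∈ p ↔ q * g ∈ p := ⟨fun hq => p.mul_mem_right _ hq, fun hq =>
      (hprime.mem_or_mem hq).resolve_right hg⟩
    have h2 : q ∈ I.colon {u} ↔ q * e ∈ I.colon {u} := ⟨fun hq => Ideal.mul_mem_right _ _ hq,
      fun hq => (h.mem_or_mem hq).resolve_right he⟩
    rw [h1, h2, hmem, Submodule.mem_colon_singleton, smul_eq_mul, mul_assoc, ← hyz, mul_add,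
      mul_assoc]
    exact I.add_mem_iff_right (I.mul_mem_left _ hy)
  · right
    push Not at hex
    refine mem_Ass_iff.2 ⟨hprime, f, le_antisymm (fun g hg => ?_) fun g hg => ?_⟩
    · rw [Submodule.mem_colon_singleton]
      exact Ideal.mem_sup_left ((hmem g).1 hg)
    · by_contra hgp
      exact hex g hgp (Submodule.mem_colon_singleton.1 hg)

theorem MonomialPrimeFiltration.Ass_subset_supp {I : Ideal (MvPolynomial (Fin n) K)}
    (F : MonomialPrimeFiltration I) : Ass I ⊆ F.supp := by
  have key : ∀ i : Fin (F.length + 1), Ass (F.ideal i) ⊆ F.supp := by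
    refine Fin.reverseInduction ?_ fun i ih => ?_
    · intro p hp
      obtain ⟨hprime, -⟩ := mem_Ass_iff.1 hp
      have := le_of_mem_Ass hp
      rw [F.ideal_last] at this
      exact absurd (top_le_iff.1 this) hprime.ne_top
    · rw [F.ideal_succ] at ih
      exact (Ass_subset_insert (F.isPrime_colon i)).trans (Set.insert_subset ⟨i, rfl⟩ ih)
  have := key 0
  rwa [F.ideal_zero] at this

theorem minimalPrimes_subset_Ass (I : Ideal (MvPolynomial (Fin n) K)) :
    I.minimalPrimes ⊆ Ass I := by
  have := Module.associatedPrimes.minimalPrimes_annihilator_subset_associatedPrimes (MvPolynomial (Fin n) K)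
    (MvPolynomial (Fin n) K ⧸ I)
  rwa [Ideal.annihilator_quotient] at this

theorem isUpperSet_mon_mem (I : Ideal (MvPolynomial (Fin n) K)) :
    IsUpperSet {a | mon K a ∈ I} := by
  intro a b hab ha
  have : (mon K b : MvPolynomial (Fin n) K) = mon K (b - a) * mon K a := by
    rw [mon, mon, mon, monomial_mul, mul_one, tsub_add_cancel_of_le hab]
  rw [Set.mem_ofPred_eq, this]
  exact I.mul_mem_left _ ha

theorem IsMonomialIdeal.eq_expIdeal {I : Ideal (MvPolynomial (Fin n) K)} (hI : IsMonomialIdeal I) :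
    I = expIdeal K {a | mon K a ∈ I} := by
  refine le_antisymm ?_ (Ideal.span_le.2 ?_)
  · obtain ⟨S, hS⟩ := hI
    conv_lhs => rw [hS]
    refine Ideal.span_mono (Set.image_mono fun a ha => ?_)
    rw [Set.mem_ofPred_eq, hS]
    exact Ideal.subset_span ⟨a, ha, rfl⟩
  · rintro _ ⟨a, ha, rfl⟩
    exact ha

theorem finite_minimalGenerators (I : Ideal (MvPolynomial (Fin n) K)) :
    (minimalGenerators I).Finite :=
  WellQuasiOrderedLE.finite_of_isAntichain (setOfPred_minimal_antichain _)

theorem multiples_minimalGenerators (I : Ideal (MvPolynomial (Fin n) K)) :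
    multiples (finite_minimalGenerators I).toFinset = {a | mon K a ∈ I} := by
  ext x
  simp only [multiples, Set.Finite.mem_toFinset, Set.mem_ofPred_eq]
  constructor
  · rintro ⟨g, hg, hgx⟩
    exact isUpperSet_mon_mem I hgx hg.1
  · intro hx
    obtain ⟨g, hgx, hg⟩ := exists_minimal_le_of_wellFoundedLT (fun b => mon K b ∈ I) x hx
    exact ⟨g, hg, hgx⟩

theorem IsGeneric.genericSet {I : Ideal (MvPolynomial (Fin n) K)} (hI : IsGeneric I) :
    GenericSet (finite_minimalGenerators I).toFinset := by
  intro a ha b hb hab t ht hpos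
  rw [Set.Finite.mem_toFinset] at ha hb
  obtain ⟨c, hc, -, -, hle, hsupp⟩ := hI.exists_strictlyDivides a ha b hb hab ⟨t, ht, hpos⟩
  refine ⟨c, (Set.Finite.mem_toFinset _).2 hc, fun r => ?_⟩
  have h1 : c r ≤ max (a r) (b r) := hle r
  have h2 := congrArg (fun s : Finset (Fin n) => r ∈ s) hsupp
  simp only [Finsupp.mem_support_iff, Finsupp.tsub_apply, Finsupp.sup_apply, eq_iff_iff] at h2
  -- Where the lcm has positive degree, equal supports make `c r` strictly smaller; elsewhere `c r =
  -- 0`, matching the truncated `0 - 1`.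
  omega

theorem IsGeneric.exists_filtration {I : Ideal (MvPolynomial (Fin n) K)} (hI : IsGeneric I) :
    ∃ F : MonomialPrimeFiltration I, F.supp = Ass I := by
  have hch := hI.genericSet.exists_chain Finset.univ _ (by simp)
  rw [multiples_minimalGenerators] at hch
  have hU := isUpperSet_mon_mem I
  obtain ⟨F, hF⟩ := exists_filtration_of_chain (K := K) hU hch
  have heq := hI.isMonomialIdeal.eq_expIdeal
  -- Hiding that `U` depends on `I` allows `I` to be replaced by `expIdeal K U`, the ideal that `F`
  -- filters.
  generalize {a | mon K a ∈ I} = U at *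
  subst heq
  refine ⟨F, F.Ass_subset_supp.antisymm' fun p hp => ?_⟩
  obtain ⟨T, ⟨a, ha⟩, rfl⟩ := hF hp
  have hc := colon_expIdeal_eq_of_prime (K := K) hU ha
  rw [← hc]
  exact colon_mem_Ass (hc ▸ isPrime_expIdeal_variables T)

theorem minimalPrimes_eq_minAss (I : Ideal (MvPolynomial (Fin n) K)) :
    I.minimalPrimes = minAss I := by
  ext p
  constructor
  · intro hp
    refine ⟨minimalPrimes_subset_Ass I hp, fun q hq hqp => ?_⟩
    exact hp.2 ⟨(mem_Ass_iff.1 hq).1, le_of_mem_Ass hq⟩ hqp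
  · rintro ⟨hp, hmin⟩
    have := (mem_Ass_iff.1 hp).1
    obtain ⟨q, hq, hqp⟩ := Ideal.exists_minimalPrimes_le (le_of_mem_Ass hp)
    rwa [le_antisymm (hmin (minimalPrimes_subset_Ass I hq) hqp) hqp]

end Ideals

end MonomialFiltration

theorem lemmaL1 {n : ℕ} {K : Type*} [Field K] (I : Ideal (MvPolynomial (Fin n) K))
    (hI : MonomialFiltration.IsGeneric I) :
    (∃ F : MonomialFiltration.MonomialPrimeFiltration I, F.supp = MonomialFiltration.Ass I) ∧
      MonomialFiltration.IsAlmostClean I ∧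
      (MonomialFiltration.IsClean I ↔ MonomialFiltration.minAss I = MonomialFiltration.Ass I) := by
  refine ⟨hI.exists_filtration, hI.exists_filtration, ?_, fun h => ?_⟩
  · rintro ⟨F, hF⟩
    rw [← MonomialFiltration.minimalPrimes_eq_minAss]
    -- `Ass I` is squeezed between the minimal primes and the support of a clean filtration.
    exact (MonomialFiltration.minimalPrimes_subset_Ass I).antisymm
      (F.Ass_subset_supp.trans hF)
  · obtain ⟨F, hF⟩ := hI.exists_filtration
    refine ⟨F, fun p hp => ?_⟩
    rw [MonomialFiltration.minimalPrimes_eq_minAss, h, ← hF]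
    exact hp
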